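/- Let $p$ be a prime with $p\neq 2$, let $F$ be a field of characteristic $p$, let $n$ be a natural number with $p\nmid n$, and let $R=M_n(F)$. Write $R^{(-)}$ for the Lie algebra with underlying space $R$ and bracket $[a,b]=ab-ba$. Let $G$ be a finite abelian $p$-group and let $K=(FG)^*$ be the Hopf algebra dual to the group algebra $FG$: its product is $(f'f'')(h)=\sum f'(h_1)f''(h_2)$, its unit is the counit of $FG$, its coproduct $\Delta(f)=\sum f_1\otimes f_2$ is determined by $\sum f_1(h')f_2(h'')=f(h'h'')$ for all $h',h''\in FG$, and its counit is $\varepsilon(f)=f(1)$. For a (not necessarily associative) $F$-algebra $A$, a $K$-module algebra structure on $A$ is a $K$-module structure on the vector space $A$, i.e. a unital algebra homomorphism $K\to\mathrm{End}_F(A)$, such that $k\cdot(ab)=\sum (k_1\cdot a)(k_2\cdot b)$ for all $k\in K$, $a,b\in A$. An element $a\in A$ is $K$-invariant if $k\cdot a=\varepsilon(k)a$ for all $k\in K$. **Theorem.** Every $K$-module algebra structure on the Lie algebra $R^{(-)}$ for which the identity matrix $1\in R$ is $K$-invariant is also a $K$-module algebra structure on the associative unital algebra $R$; that is, $k\cdot(ab)=\sum(k_1\cdot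 a)(k_2\cdot b)$ for all $k\in K$ and $a,b\in R$, and $k\cdot 1=\varepsilon(k)1$ for all $k\in K$. -/

import Mathlib

open scoped TensorProduct

noncomputable section

/-- The linear dual `H* = Hom_R(H, R)` of a coalgebra `H`, with the convolution product
`(f * g)(h) = ∑ f(h₁) g(h₂)`, whose unit is the counit of `H`. -/
def HopfDual (R H : Type*) [CommRing R] [Ring H] [Bialgebra R H] : Type _ :=
  WithConv (H →ₗ[R] R)

namespace HopfDual

open Coalgebra TensorProduct

section Defs

variable (R H : Type*) [CommRing R] [Ring H] [Bialgebra R H]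

instance instRing : Ring (HopfDual R H) := inferInstanceAs (Ring (WithConv (H →ₗ[R] R)))

instance instAlgebra : Algebra R (HopfDual R H) :=
  inferInstanceAs (Algebra R (WithConv (H →ₗ[R] R)))

/-- The identification of `H*` with the space of linear functionals on `H`. -/
def toDual : HopfDual R H ≃ₗ[R] Module.Dual R H where
  toFun f := WithConv.ofConv f
  invFun f := WithConv.toConv f
  map_add' _ _ := rfl
  map_smul' _ _ := rfl
  left_inv _ := rfl
  right_inv _ := rfl

/-- Evaluation `f ↦ f(h)`. -/
def ev (h : H) : HopfDual R H →ₗ[R] R :=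
  LinearMap.applyₗ h ∘ₗ (toDual R H).toLinearMap

/-- For `H` finite and free, the isomorphism `H* ⊗ H* ≃ (H ⊗ H)*` sending `f ⊗ g` to the
functional `h' ⊗ h'' ↦ f(h') g(h'')`. -/
def tensorEquiv [Module.Finite R H] [Module.Free R H] :
    HopfDual R H ⊗[R] HopfDual R H ≃ₗ[R] Module.Dual R (H ⊗[R] H) :=
  TensorProduct.congr (toDual R H) (toDual R H) ≪≫ₗ
    TensorProduct.dualDistribEquiv R H H

/-- Comultiplication of `H*`, the transpose of multiplication of `H`: it is determined by
`∑ f₁(h') f₂(h'') = f(h' h'')`. -/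
def comulMap [Module.Finite R H] [Module.Free R H] :
    HopfDual R H →ₗ[R] HopfDual R H ⊗[R] HopfDual R H :=
  (tensorEquiv R H).symm.toLinearMap ∘ₗ (LinearMap.mul' R H).dualMap ∘ₗ
    (toDual R H).toLinearMap

end Defs

section Lemmas

variable {R H : Type*} [CommRing R] [Ring H] [Bialgebra R H]

@[ext] lemma ext {f g : HopfDual R H} (h : ∀ x, ev R H x f = ev R H x g) : f = g :=
  (toDual R H).injective (LinearMap.ext h)

lemma ev_mul {ι : Type*} {h : H} (r : Repr R h ι) (f g : HopfDual R H) :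
    ev R H h (f * g) = ∑ i ∈ r.index, ev R H (r.left i) f * ev R H (r.right i) g :=
  r.convMul_apply f g

@[simp] lemma ev_one (h : H) : ev R H h 1 = counit (R := R) h := rfl

section

/-- The functional `f ⊗ g ↦ f(h) g(k)`. -/
def ev₂ (h k : H) : HopfDual R H ⊗[R] HopfDual R H →ₗ[R] R :=
  LinearMap.mul' R R ∘ₗ TensorProduct.map (ev R H h) (ev R H k)

@[simp] lemma ev₂_tmul (h k : H) (f g : HopfDual R H) : 
    ev₂ h k (f ⊗ₜ[R] g) = ev R H h f * ev R H k g := rfl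

variable [Module.Finite R H] [Module.Free R H]

lemma tensorEquiv_apply (x : HopfDual R H ⊗[R] HopfDual R H) (h k : H) :
    tensorEquiv R H x (h ⊗ₜ[R] k) = ev₂ h k x := by
  induction x with
  | zero => simp
  | add x y hx hy => simp [hx, hy]
  | tmul f g => rfl

@[simp] lemma ev₂_comulMap (h k : H) (f : HopfDual R H) : 
    ev₂ h k (comulMap R H f) = ev R H (h * k) f := by
  rw [← tensorEquiv_apply]
  simp [comulMap]
  rfl

lemma ext_left {M : Type*} [AddCommGroup M] [Module R M] {x y : HopfDual R H ⊗[R] M}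
    (hxy : ∀ h, TensorProduct.lid R M ((ev R H h).rTensor M x) =
      TensorProduct.lid R M ((ev R H h).rTensor M y)) : x = y := by
  let e : HopfDual R H ⊗[R] M ≃ₗ[R] (H →ₗ[R] M) :=
    TensorProduct.congr (toDual R H) (LinearEquiv.refl R M) ≪≫ₗ
      dualTensorHomEquiv R H M
  have he : ∀ z h, e z h = TensorProduct.lid R M ((ev R H h).rTensor M z) := by
    intro z h
    induction z with
    | zero => simp
    | add x y hx hy => simp [hx, hy]
    | tmul f m => rfl
  apply e.injective
  ext h
  rw [he, he, hxy]

lemma ext₂ {x y : HopfDual R H ⊗[R] HopfDual R H} (hxy : ∀ h k, ev₂ h k x = ev₂ h k y) :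
    x = y := by
  apply (tensorEquiv R H).injective
  apply TensorProduct.ext'
  intro h k
  rw [tensorEquiv_apply, tensorEquiv_apply, hxy]

end

/-- The functional `f ⊗ (g ⊗ l) ↦ f(a) g(b) l(c)`. -/
def ev₃ (a b c : H) :
    HopfDual R H ⊗[R] (HopfDual R H ⊗[R] HopfDual R H) →ₗ[R] R :=
  LinearMap.mul' R R ∘ₗ TensorProduct.map (ev R H a) (ev₂ b c)

lemma ext₃ [Module.Finite R H] [Module.Free R H]
    {x y : HopfDual R H ⊗[R] (HopfDual R H ⊗[R] HopfDual R H)}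
    (hxy : ∀ a b c, ev₃ a b c x = ev₃ a b c y) : x = y := by
  apply ext_left
  intro a
  apply ext₂
  intro b c
  have key : ∀ z : HopfDual R H ⊗[R] (HopfDual R H ⊗[R] HopfDual R H),
      ev₂ b c (TensorProduct.lid R _ ((ev R H a).rTensor _ z)) = ev₃ a b c z := by
    intro z
    induction z with
    | zero => simp
    | add x y hx hy => simp [hx, hy]
    | tmul f m => simp [ev₃]
  rw [key, key, hxy]

section Coalg

variable [Module.Finite R H] [Module.Free R H]

instance instCoalgebra : Coalgebra R (HopfDual R H) where
  comul := comulMap R H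
  counit := ev R H 1
  coassoc := by
    apply LinearMap.ext
    intro f
    apply ext₃
    intro a b c
    have h1 : ∀ z : HopfDual R H ⊗[R] HopfDual R H,
        ev₃ a b c (TensorProduct.assoc R _ _ _ ((comulMap R H).rTensor _ z)) =
          ev₂ (a * b) c z := by
      intro z
      induction z with
      | zero => simp
      | add x y hx hy => simp [hx, hy]
      | tmul f g =>
        rw [LinearMap.rTensor_tmul, ev₂_tmul, ← ev₂_comulMap]
        generalize comulMap R H f = w
        induction w with
        | zero => simp
        | add x y hx hy => simp [hx, hy, TensorProduct.add_tmul, add_mul]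
        | tmul u v => simp [ev₃, mul_assoc]
    have h2 : ∀ z : HopfDual R H ⊗[R] HopfDual R H,
        ev₃ a b c ((comulMap R H).lTensor _ z) = ev₂ a (b * c) z := by
      intro z
      induction z with
      | zero => simp
      | add x y hx hy => simp [hx, hy]
      | tmul f g => simp [ev₃]
    simp only [LinearMap.comp_apply, LinearEquiv.coe_coe]
    rw [h1, h2, ev₂_comulMap, ev₂_comulMap, mul_assoc]
  rTensor_counit_comp_comul := by
    apply LinearMap.ext
    intro f
    apply (TensorProduct.lid R (HopfDual R H)).injective
    apply HopfDual.ext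
    intro h
    have key : ∀ z : HopfDual R H ⊗[R] HopfDual R H,
        ev R H h (TensorProduct.lid R (HopfDual R H) ((ev R H 1).rTensor _ z)) = ev₂ 1 h z := by
      intro z
      induction z with
      | zero => simp
      | add x y hx hy => simp [hx, hy]
      | tmul f g => simp
    simp only [LinearMap.comp_apply]
    rw [key, ev₂_comulMap]
    simp
  lTensor_counit_comp_comul := by
    apply LinearMap.ext
    intro f
    apply (TensorProduct.rid R (HopfDual R H)).injective
    apply HopfDual.ext
    intro h
    have key : ∀ z : HopfDual R H ⊗[R] HopfDual R H,
        ev R H h (TensorProduct.rid R (HopfDual R H) ((ev R H 1).lTensor _ z)) = ev₂ h 1 z := by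
      intro z
      induction z with
      | zero => simp
      | add x y hx hy => simp [hx, hy]
      | tmul f g => simp [mul_comm]
    simp only [LinearMap.comp_apply]
    rw [key, ev₂_comulMap]
    simp

lemma comul_def (f : HopfDual R H) : comul (R := R) f = comulMap R H f := rfl

lemma counit_def (f : HopfDual R H) : counit (R := R) f = ev R H 1 f := rfl

end Coalg

section Bialg

lemma ev₂_mul {ι κ : Type*} {h k : H} (rh : Repr R h ι) (rk : Repr R k κ)
    (x y : HopfDual R H ⊗[R] HopfDual R H) :
    ev₂ h k (x * y) = ∑ i ∈ rh.index, ∑ j ∈ rk.index,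
      ev₂ (rh.left i) (rk.left j) x * ev₂ (rh.right i) (rk.right j) y := by
  induction x with
  | zero => simp
  | add x₁ x₂ h₁ h₂ => simp [add_mul, h₁, h₂, Finset.sum_add_distrib]
  | tmul f g =>
    induction y with
    | zero => simp
    | add y₁ y₂ h₁ h₂ => simp [mul_add, h₁, h₂, Finset.sum_add_distrib]
    | tmul f' g' =>
      rw [Algebra.TensorProduct.tmul_mul_tmul, ev₂_tmul, ev_mul rh, ev_mul rk,
        Finset.sum_mul_sum]
      refine Finset.sum_congr rfl fun i _ ↦ Finset.sum_congr rfl fun j _ ↦ ?_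
      simp only [ev₂_tmul]
      ring

instance instBialgebra [Module.Finite R H] [Module.Free R H] :
    Bialgebra R (HopfDual R H) :=
  Bialgebra.mk' R (HopfDual R H)
    (by rw [counit_def]; simp)
    (by
      intro f g
      rw [counit_def, ev_mul ⟨{()}, fun _ ↦ 1, fun _ ↦ 1, by simp [Algebra.TensorProduct.one_def]⟩]
      simp [counit_def])
    (by
      apply ext₂
      intro h k
      rw [comul_def, ev₂_comulMap]
      simp [Algebra.TensorProduct.one_def])
    (by
      intro f g
      apply ext₂
      intro h k
      rw [comul_def, comul_def, comul_def, ev₂_comulMap, ev₂_mul (ℛ R h) (ℛ R k)]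
      simp only [ev₂_comulMap]
      rw [ev_mul ⟨(ℛ R h).index ×ˢ (ℛ R k).index,
        fun i ↦ (ℛ R h).left i.1 * (ℛ R k).left i.2,
        fun i ↦ (ℛ R h).right i.1 * (ℛ R k).right i.2, ?_⟩, Finset.sum_product]
      rw [Bialgebra.comul_mul, ← (ℛ R h).eq, ← (ℛ R k).eq, Finset.sum_mul_sum,
        Finset.sum_product]
      simp)

lemma ev_mul' {ι : Type*} {h : H} (r : Repr R h ι) (z : HopfDual R H ⊗[R] HopfDual R H) :
    ev R H h (LinearMap.mul' R (HopfDual R H) z) =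
      ∑ i ∈ r.index, ev₂ (r.left i) (r.right i) z := by
  induction z with
  | zero => simp
  | add x y hx hy => simp [hx, hy, Finset.sum_add_distrib]
  | tmul f g => simp [ev_mul r]

end Bialg

end Lemmas

section Hopf

variable (R H : Type*) [CommRing R] [Ring H] [HopfAlgebra R H]

/-- The antipode of `H*`, the transpose of the antipode of `H`. -/
def antipodeMap : HopfDual R H →ₗ[R] HopfDual R H :=
  (toDual R H).symm.toLinearMap ∘ₗ
    (HopfAlgebra.antipode R (A := H)).dualMap ∘ₗ (toDual R H).toLinearMap

variable {R H}

lemma ev_antipodeMap (h : H) (f : HopfDual R H) :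
    ev R H h (antipodeMap R H f) = ev R H (HopfAlgebra.antipode R h) f := rfl

lemma ev_algebraMap (h : H) (r : R) :
    ev R H h (algebraMap R (HopfDual R H) r) = r * counit (R := R) h := by
  rw [Algebra.algebraMap_eq_smul_one, map_smul, ev_one, smul_eq_mul]

instance instHopfAlgebra [Module.Finite R H] [Module.Free R H] :
    HopfAlgebra R (HopfDual R H) where
  antipode := antipodeMap R H
  mul_antipode_rTensor_comul := by
    apply LinearMap.ext
    intro f
    apply HopfDual.ext
    intro h
    have key : ∀ (a b : H) (z : HopfDual R H ⊗[R] HopfDual R H),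
        ev₂ a b ((antipodeMap R H).rTensor _ z) = ev₂ (HopfAlgebra.antipode R a) b z := by
      intro a b z
      induction z with
      | zero => simp
      | add x y hx hy => simp [hx, hy]
      | tmul f g => simp [ev_antipodeMap]
    simp only [LinearMap.comp_apply, Algebra.linearMap_apply]
    rw [ev_mul' (ℛ R h), ev_algebraMap, counit_def, comul_def]
    simp only [key, ev₂_comulMap]
    have := congrArg (toDual R H f) (HopfAlgebra.sum_antipode_mul_eq_algebraMap_counit (ℛ R h))
    rw [map_sum, Algebra.algebraMap_eq_smul_one, map_smul, smul_eq_mul, mul_comm] at this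
    exact this
  mul_antipode_lTensor_comul := by
    apply LinearMap.ext
    intro f
    apply HopfDual.ext
    intro h
    have key : ∀ (a b : H) (z : HopfDual R H ⊗[R] HopfDual R H),
        ev₂ a b ((antipodeMap R H).lTensor _ z) = ev₂ a (HopfAlgebra.antipode R b) z := by
      intro a b z
      induction z with
      | zero => simp
      | add x y hx hy => simp [hx, hy]
      | tmul f g => simp [ev_antipodeMap]
    simp only [LinearMap.comp_apply, Algebra.linearMap_apply]
    rw [ev_mul' (ℛ R h), ev_algebraMap, counit_def, comul_def]
    simp only [key, ev₂_comulMap]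
    have := congrArg (toDual R H f) (HopfAlgebra.sum_mul_antipode_eq_algebraMap_counit (ℛ R h))
    rw [map_sum, Algebra.algebraMap_eq_smul_one, map_smul, smul_eq_mul, mul_comm] at this
    exact this

end Hopf

end HopfDual

section ModuleAlgebra

variable {F K A : Type*} [Field F] [Ring K] [HopfAlgebra F K] [AddCommGroup A] [Module F A]

/-- Let the Hopf algebra `K` act on a vector space `A` through `ρ : K → End_F(A)`, and let `μ` be a
bilinear product on `A`, not necessarily associative or unital. The action makes `(A, μ)` a
`K`-module algebra if `k · μ(a, b) = ∑ μ(k₁ · a, k₂ · b)` for all `k`, `a`, `b`. -/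
def IsModuleAlgebra (ρ : K →ₐ[F] Module.End F A) (μ : A →ₗ[F] A →ₗ[F] A) : Prop :=
  ∀ (k : K) (a b : A), ρ k (μ a b) =
    TensorProduct.lift (μ.compl₁₂ (ρ.toLinearMap.flip a) (ρ.toLinearMap.flip b))
      (Coalgebra.comul (R := F) k)

/-- The element `a` is `K`-invariant: `k · a = ε(k) a` for all `k`. -/
def IsInvariantElement (ρ : K →ₐ[F] Module.End F A) (a : A) : Prop :=
  ∀ k : K, ρ k a = Coalgebra.counit (R := F) k • a

end ModuleAlgebra

/-- The commutator product `(a, b) ↦ ⁅a, b⁆ = a b - b a` of the Lie algebra `A⁽⁻⁾` of an associative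
algebra `A`. -/
def commutatorProduct (F A : Type*) [Field F] [Ring A] [Algebra F A] : A →ₗ[F] A →ₗ[F] A :=
  LinearMap.mk₂ F (fun a b ↦ ⁅a, b⁆)
    (by intros; simp only [Ring.lie_def]; noncomm_ring)
    (by intros; simp only [Ring.lie_def, smul_mul_assoc, mul_smul_comm, smul_sub])
    (by intros; simp only [Ring.lie_def]; noncomm_ring)
    (by intros; simp only [Ring.lie_def, smul_mul_assoc, mul_smul_comm, smul_sub])

end

/-! Put `H = FG`. By double duality an action of `H*` on matrices is a linear map `Φ : Mₙ(F) →
Mₙ(H)`. It reduces to the identity along the counit, is unital by invariance of `1`, and preserves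
brackets. Consider the defect `E(a, b) = Φ(ab) - Φ(a)Φ(b)` and the ideal `J` spanned by its entries.
Since `G` is a `p`-group, the augmentation ideal `m` of `H` is nil, so by Nakayama it suffices to
show `J = mJ` (`Matrix.map_mul_of_map_lie`).

Modulo `mJ`, associativity makes `E` a Hochschild 2-cocycle, and the bracket condition makes it
symmetric. Such a cocycle vanishes (`Matrix.eq_zero_of_symm_cocycle`): separability writes it as the
coboundary of some `f`, symmetry says that `f` is a Lie derivation, hence inner plus central, and `f
1 = 0` kills the central part. So `f` is a derivation and its coboundary is zero. -/

noncomputable section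

namespace Matrix

variable {ι F : Type*} [Fintype ι] [DecidableEq ι] [Field F]

/-! ### The Casimir element of the matrix algebra -/

section Casimir

variable {M : Type*} [AddCommGroup M] [Module F M]

lemma mul_single_one_eq_sum (a : Matrix ι ι F) (i j : ι) :
    a * single i j 1 = ∑ k, a k i • single k j (1 : F) := by
  ext r s
  simp [Matrix.mul_apply, Matrix.sum_apply, single_apply, ite_and]

lemma single_one_mul_eq_sum (a : Matrix ι ι F) (i j : ι) :
    single i j 1 * a = ∑ k, a j k • single i k (1 : F) := by
  ext r s
  simp [Matrix.mul_apply, Matrix.sum_apply, single_apply, ite_and]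

/-- The element `c = ∑ eᵢⱼ ⊗ eⱼᵢ` satisfies `(a ⊗ 1) c = c (1 ⊗ a)`. A bilinear `B` is used in place
of the tensor product, so that the identity applies to any expression in the two legs. -/
lemma sum_mul_single_single (B : Matrix ι ι F →ₗ[F] Matrix ι ι F →ₗ[F] M) (a : Matrix ι ι F) :
    ∑ i, ∑ j, B (a * single i j 1) (single j i 1) =
      ∑ i, ∑ j, B (single i j 1) (single j i 1 * a) := by
  simp only [mul_single_one_eq_sum, single_one_mul_eq_sum, map_sum, map_smul,
    LinearMap.sum_apply, LinearMap.smul_apply]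
  calc _ = ∑ i, ∑ k, ∑ j, a k i • B (single k j 1) (single j i 1) :=
        Finset.sum_congr rfl fun _ _ ↦ Finset.sum_comm
    _ = ∑ k, ∑ i, ∑ j, a k i • B (single k j 1) (single j i 1) := Finset.sum_comm
    _ = _ := Finset.sum_congr rfl fun _ _ ↦ Finset.sum_comm

lemma sum_single_mul_single (B : Matrix ι ι F →ₗ[F] Matrix ι ι F →ₗ[F] M) (a : Matrix ι ι F) :
    ∑ i, ∑ j, B (single i j 1 * a) (single j i 1) =
      ∑ i, ∑ j, B (single i j 1) (a * single j i 1) := by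
  rw [Finset.sum_comm, Finset.sum_comm (f := fun i j ↦ B (single i j 1) (a * single j i 1))]
  exact (sum_mul_single_single B.flip a).symm

lemma sum_single_mul_mul_single (u : Matrix ι ι F) :
    ∑ i, ∑ j, single i j 1 * u * single j i 1 = u.trace • (1 : Matrix ι ι F) := by
  ext r s
  simp [Matrix.sum_apply, Matrix.trace, Matrix.one_apply, Matrix.single_apply, ite_and,
    Finset.sum_ite_eq, eq_comm]

lemma sum_single_mul_single_self :
    ∑ i, ∑ j, single i j (1 : F) * single j i 1 = (Fintype.card ι : F) • (1 : Matrix ι ι F) := by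
  simpa using sum_single_mul_mul_single (1 : Matrix ι ι F)

/-- This is the Casimir operator of `gl(n)` in the adjoint representation: `2n` on traceless
matrices, zero on scalars. -/
lemma sum_lie_lie_single (u : Matrix ι ι F) :
    ∑ i, ∑ j, ⁅⁅u, single i j (1 : F)⁆, single j i (1 : F)⁆ =
      (2 * Fintype.card ι : F) • u - (2 * u.trace) • (1 : Matrix ι ι F) := by
  have expand : ∀ x z : Matrix ι ι F, ⁅⁅u, x⁆, z⁆ =
      u * (x * z) - x * u * z - z * u * x + z * x * u := by
    intro x z
    simp only [Ring.lie_def]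
    noncomm_ring
  have swap : ∑ i, ∑ j, single j i 1 * u * single i j 1 = u.trace • (1 : Matrix ι ι F) := by
    rw [Finset.sum_comm, sum_single_mul_mul_single]
  have swap' : ∑ i, ∑ j, single j i (1 : F) * single i j 1 =
      (Fintype.card ι : F) • (1 : Matrix ι ι F) := by
    rw [Finset.sum_comm, sum_single_mul_single_self]
  simp only [expand, Finset.sum_add_distrib, Finset.sum_sub_distrib, ← Finset.mul_sum,
    ← Finset.sum_mul]
  rw [swap, swap', sum_single_mul_mul_single, sum_single_mul_single_self]
  simp only [mul_smul_comm, smul_mul_assoc, mul_one, one_mul]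
  module

end Casimir

/-! ### Lie derivations and symmetric 2-cocycles -/

/-- A Lie derivation of a matrix algebra is the sum of an inner derivation and a central map. -/
lemma exists_eq_lie_add_trace (h2 : (2 : F) ≠ 0) (hι : (Fintype.card ι : F) ≠ 0)
    (f : Matrix ι ι F →ₗ[F] Matrix ι ι F) (hf : ∀ a b, f ⁅a, b⁆ = ⁅f a, b⁆ + ⁅a, f b⁆) :
    ∃ y : Matrix ι ι F, ∀ b, f b = ⁅y, b⁆ + ((Fintype.card ι : F)⁻¹ * (f b).trace) • 1 := by
  let B : Matrix ι ι F →ₗ[F] Matrix ι ι F →ₗ[F] Matrix ι ι F := (commutatorProduct F _).comp f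
  have hB : ∀ a b, B a b = ⁅f a, b⁆ := fun _ _ ↦ rfl
  let y₀ : Matrix ι ι F := ∑ i, ∑ j, B (single i j 1) (single j i 1)
  have key : ∀ b, b * y₀ - y₀ * b =
      -((2 * Fintype.card ι : F) • f b - (2 * (f b).trace) • (1 : Matrix ι ι F)) := by
    intro b
    -- Jacobi and the Lie derivation rule move `ad b` onto the arguments of `B`. After summation
    -- over the Casimir element these terms cancel, leaving only the double bracket with `f b`.
    have expand : ∀ x z, b * B x z - B x z * b = B (b * x) z - B (x * b) z + (B x (b * z) - B x (z * b)) -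
        ⁅⁅f b, x⁆, z⁆ := by
      intro x z
      rw [← LinearMap.sub_apply, ← map_sub, ← map_sub, hB, hB, hB, ← Ring.lie_def b x, hf]
      simp only [Ring.lie_def]
      noncomm_ring
    simp only [y₀, Finset.mul_sum, Finset.sum_mul]
    simp only [← Finset.sum_sub_distrib, expand]
    simp only [Finset.sum_add_distrib, Finset.sum_sub_distrib]
    rw [sum_mul_single_single, sum_single_mul_single, sum_lie_lie_single]
    abel
  refine ⟨(2 * Fintype.card ι : F)⁻¹ • y₀, fun b ↦ ?_⟩
  rw [Ring.lie_def, smul_mul_assoc, mul_smul_comm, ← smul_sub, ← neg_sub, key, neg_neg, smul_sub, smul_smul, smul_smul,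
    inv_mul_cancel₀ (mul_ne_zero h2 hι), one_smul, sub_add, ← sub_smul]
  have : (2 * (Fintype.card ι : F))⁻¹ * (2 * (f b).trace) -
      (Fintype.card ι : F)⁻¹ * (f b).trace = 0 := by
    field_simp
    ring
  rw [this, zero_smul, sub_zero]

/-- A linear functional vanishing on commutators and on the identity vanishes. -/
lemma eq_zero_of_map_mul_comm (hι : (Fintype.card ι : F) ≠ 0) (τ : Matrix ι ι F →ₗ[F] F)
    (hτ : ∀ a b, τ (a * b) = τ (b * a)) (h1 : τ 1 = 0) : τ = 0 := by
  have hne : ∀ i j, i ≠ j → τ (single i j 1) = 0 := by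
    intro i j hij
    have := hτ (single i i 1) (single i j 1)
    rwa [single_mul_single_same, one_mul, single_mul_single_of_ne _ _ _ _ hij.symm,
      map_zero] at this
  have hdiag : ∀ i j, τ (single i i 1) = τ (single j j 1) := by
    intro i j
    simpa using hτ (single i j 1) (single j i 1)
  have hzero : ∀ i, τ (single i i 1) = 0 := by
    intro i
    have hone : (1 : Matrix ι ι F) = ∑ j, single j j 1 := by
      rw [sum_single_one]
    rw [hone, map_sum, Finset.sum_congr rfl fun j _ ↦ hdiag j i, Finset.sum_const,
      Finset.card_univ, nsmul_eq_mul] at h1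
    exact (mul_eq_zero.mp h1).resolve_left hι
  refine Matrix.ext_linearMap _ fun i j ↦ LinearMap.ext_ring ?_
  rcases eq_or_ne i j with rfl | hij
  · simpa using hzero i
  · simpa using hne i j hij

/-- A normalized symmetric Hochschild 2-cocycle on a matrix algebra is zero. -/
lemma eq_zero_of_symm_cocycle (h2 : (2 : F) ≠ 0) (hι : (Fintype.card ι : F) ≠ 0)
    (E : Matrix ι ι F →ₗ[F] Matrix ι ι F →ₗ[F] Matrix ι ι F) (hsymm : ∀ a b, E a b = E b a)
    (hcoc : ∀ a b c, E (a * b) c + E a b * c = E a (b * c) + a * E b c) (h1 : E 1 1 = 0) :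
    E = 0 := by
  -- Contraction of `E` with the separability idempotent `n⁻¹ ∑ eᵢⱼ ⊗ eⱼᵢ`; this is where `n` must
  -- be invertible.
  let f : Matrix ι ι F →ₗ[F] Matrix ι ι F := (Fintype.card ι : F)⁻¹ •
    ∑ i, ∑ j, LinearMap.mulLeft F (single i j 1) ∘ₗ E (single j i 1)
  have hf : ∀ a, f a = (Fintype.card ι : F)⁻¹ • ∑ i, ∑ j, single i j 1 * E (single j i 1) a := by
    intro a
    simp [f, LinearMap.sum_apply]
  have hE : ∀ a b, E a b = a * f b - f (a * b) + f a * b := by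
    intro a b
    have h := sum_mul_single_single ((LinearMap.mul F (Matrix ι ι F)).compl₂ (E.flip b)) a
    simp only [LinearMap.compl₂_apply, LinearMap.mul_apply', LinearMap.flip_apply] at h
    have expand : ∀ x z, x * E (z * a) b = x * E z (a * b) + x * z * E a b - x * E z a * b := by
      intro x z
      rw [eq_sub_of_add_eq (hcoc z a b)]
      noncomm_ring
    simp only [expand, Finset.sum_add_distrib, Finset.sum_sub_distrib, ← Finset.sum_mul,
      sum_single_mul_single_self, mul_assoc a, ← Finset.mul_sum] at h
    rw [hf, hf, hf, mul_smul_comm, h, smul_sub, smul_add, smul_mul_assoc, smul_mul_assoc,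
      one_mul, smul_smul, inv_mul_cancel₀ hι, one_smul]
    abel
  -- Antisymmetrizing the coboundary formula gives exactly the Lie derivation defect of `f`.
  have hlie : ∀ a b, f ⁅a, b⁆ = ⁅f a, b⁆ + ⁅a, f b⁆ := by
    intro a b
    have h := hsymm a b
    rw [hE, hE] at h
    simp only [Ring.lie_def, map_sub]
    rw [← sub_eq_zero] at h ⊢
    rw [← neg_eq_zero, ← h]
    abel
  obtain ⟨y, hy⟩ := exists_eq_lie_add_trace h2 hι f hlie
  have hf1 : f 1 = 0 := by
    have h := hE 1 1
    rw [h1] at h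
    simpa using h.symm
  -- `tr ∘ f` kills commutators, since `f` maps them to sums of commutators, and it kills `1`.
  have hτ : traceLinearMap ι F F ∘ₗ f = 0 := by
    refine eq_zero_of_map_mul_comm hι _ (fun a b ↦ ?_) (by simp [hf1])
    rw [← sub_eq_zero, ← map_sub, ← Ring.lie_def, LinearMap.comp_apply, hlie]
    rw [Ring.lie_def, Ring.lie_def, map_add, map_sub, map_sub]
    simp only [traceLinearMap_apply, trace_mul_comm b, trace_mul_comm a]
    abel
  have hinner : ∀ b, f b = ⁅y, b⁆ := by
    intro b
    have h := hy b
    rwa [show (f b).trace = 0 from LinearMap.congr_fun hτ b, mul_zero, zero_smul, add_zero] at h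
  ext1 a
  ext1 b
  rw [hE, hinner, hinner, hinner]
  simp only [Ring.lie_def, LinearMap.zero_apply]
  noncomm_ring

end Matrix

/-! ### Multiplicativity by Nakayama's lemma -/

section Deformation

open Matrix

variable {ι F H : Type*} [Fintype ι] [DecidableEq ι] [Field F] [CommRing H] [Algebra F H]

/-- Let `ε` be an augmentation of a Noetherian algebra `H` with kernel in the Jacobson radical.
A unital Lie homomorphism `Mₙ(F) → Mₙ(H)` lifting the identity modulo `ker ε` is multiplicative. -/
theorem Matrix.map_mul_of_map_lie [IsNoetherianRing H] (h2 : (2 : F) ≠ 0)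
    (hι : (Fintype.card ι : F) ≠ 0) (ε : H →ₐ[F] F)
    (hε : RingHom.ker ε ≤ Ideal.jacobson ⊥) (Φ : Matrix ι ι F →ₗ[F] Matrix ι ι H)
    (hΦε : ∀ a, (Φ a).map ε = a) (hΦ1 : Φ 1 = 1)
    (hlie : ∀ a b, Φ ⁅a, b⁆ = ⁅Φ a, Φ b⁆) (a b : Matrix ι ι F) :
    Φ (a * b) = Φ a * Φ b := by
  let E : Matrix ι ι F →ₗ[F] Matrix ι ι F →ₗ[F] Matrix ι ι H :=
    (LinearMap.mul F _).compr₂ Φ - (LinearMap.mul F _).compl₁₂ Φ Φ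
  have hE : ∀ a b, E a b = Φ (a * b) - Φ a * Φ b := fun _ _ ↦ rfl
  let J : Ideal H := Ideal.span {x | ∃ a b i j, x = E a b i j}
  have hEJ : ∀ a b i j, E a b i j ∈ J := fun a b i j ↦ Ideal.subset_span ⟨a, b, i, j, rfl⟩
  have hsymm : ∀ a b, E a b = E b a := by
    intro a b
    have h := hlie a b
    simp only [Ring.lie_def, map_sub] at h
    rw [hE, hE, ← sub_eq_zero]
    rw [← sub_eq_zero] at h
    rw [← h]
    abel
  have hcoc : ∀ a b c, E (a * b) c + E a b * Φ c = E a (b * c) + Φ a * E b c := by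
    intro a b c
    simp only [hE, mul_assoc]
    noncomm_ring
  have hJ : J ≤ RingHom.ker ε • J := by
    refine Ideal.span_le.mpr ?_
    rintro _ ⟨a, b, i, j, rfl⟩
    by_contra hnot
    -- A functional that is zero on `mJ` but not on the chosen entry reduces the problem to a
    -- cocycle with values in `Mₙ(F)`.
    obtain ⟨l, hl, hker⟩ := Submodule.exists_le_ker_of_notMem
      (p := (RingHom.ker ε • J).restrictScalars F) hnot
    -- On `J` the functional sees `H` only through `ε`, so the factors `Φ a`, `Φ c` in the twisted
    -- cocycle identity become `a`, `c`.
    have hlmul : ∀ x, ∀ z ∈ J, l (x * z) = ε x * l z := by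
      intro x z hz
      have hx : (x - algebraMap F H (ε x)) * z ∈ RingHom.ker ε • J :=
        Submodule.smul_mem_smul (by simp [RingHom.mem_ker]) hz
      have h0 : l ((x - algebraMap F H (ε x)) * z) = 0 := hker hx
      rw [sub_mul, map_sub, sub_eq_zero, ← Algebra.smul_def, map_smul, smul_eq_mul] at h0
      exact h0
    let E' : Matrix ι ι F →ₗ[F] Matrix ι ι F →ₗ[F] Matrix ι ι F := E.compr₂ l.mapMatrix
    have hE' : ∀ a b, E' a b = (E a b).map l := fun _ _ ↦ rfl
    have hεΦ : ∀ a i j, ε (Φ a i j) = a i j := fun a i j ↦ congrFun (congrFun (hΦε a) i) j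
    have hzero : E' = 0 := by
      refine eq_zero_of_symm_cocycle h2 hι E' (fun a b ↦ by rw [hE', hE', hsymm]) ?_ ?_
      · intro a b c
        ext r s
        have h := congrArg l (congrFun (congrFun (hcoc a b c) r) s)
        simp only [Matrix.add_apply, Matrix.mul_apply, map_add, map_sum] at h
        rw [Finset.sum_congr rfl fun k _ ↦ show l (E a b r k * Φ c k s) = l (E a b r k) * c k s by
            rw [mul_comm, hlmul _ _ (hEJ _ _ _ _), hεΦ, mul_comm],
          Finset.sum_congr rfl fun k _ ↦ show l (Φ a r k * E b c k s) = a r k * l (E b c k s) by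
            rw [hlmul _ _ (hEJ _ _ _ _), hεΦ]] at h
        simpa only [Matrix.add_apply, Matrix.mul_apply, hE', Matrix.map_apply] using h
      · ext r s
        simp [hE', hE, hΦ1]
    apply hl
    have h := congrFun (congrFun (LinearMap.congr_fun₂ hzero a b) i) j
    exact h
  have hJ0 : J = ⊥ := Submodule.eq_bot_of_le_smul_of_le_jacobson_bot _ J
    (IsNoetherian.noetherian J) hJ hε
  rw [← sub_eq_zero, ← hE]
  ext i j
  have h := hEJ a b i j
  rwa [hJ0, Ideal.mem_bot] at h

end Deformation

/-! ### From actions of the dual to coactions -/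

namespace HopfDual

variable {F H ι : Type*} [Field F]

section Coaction

variable [CommRing H] [HopfAlgebra F H] [Module.Finite F H]
  (ρ : HopfDual F H →ₐ[F] Module.End F (Matrix ι ι F))

/-- The coaction `Mₙ(F) → Mₙ(H)` of `H` corresponding to an action of `H*`. -/
def coaction : Matrix ι ι F →ₗ[F] Matrix ι ι H where
  toFun a := Matrix.of fun i j ↦ (Module.evalEquiv F H).symm
    (Matrix.entryLinearMap F F i j ∘ₗ ρ.toLinearMap.flip a ∘ₗ (toDual F H).symm.toLinearMap)
  map_add' a b := by
    ext i j
    simp [LinearMap.comp_add, LinearMap.add_comp]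
  map_smul' c a := by
    ext i j
    simp [LinearMap.comp_smul, LinearMap.smul_comp]

lemma ev_coaction (k : HopfDual F H) (a : Matrix ι ι F) (i j : ι) :
    ev F H (coaction ρ a i j) k = ρ k a i j := by
  change toDual F H k ((Module.evalEquiv F H).symm _) = _
  rw [Module.apply_evalEquiv_symm_apply]
  simp

lemma ev_injective {x y : H} (h : ∀ k : HopfDual F H, ev F H x k = ev F H y k) : x = y :=
  (Module.evalEquiv F H).injective (LinearMap.ext fun φ ↦ h ((toDual F H).symm φ))

lemma coaction_map_counit (a : Matrix ι ι F) :
    (coaction ρ a).map (Bialgebra.counitAlgHom F H) = a := by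
  ext i j
  rw [Matrix.map_apply, Bialgebra.counitAlgHom_apply, ← ev_one, ev_coaction, map_one,
    Module.End.one_apply]

variable [DecidableEq ι]

lemma coaction_one (hone : IsInvariantElement ρ 1) : coaction ρ 1 = 1 := by
  ext i j
  refine ev_injective (F := F) fun k ↦ ?_
  rw [ev_coaction, hone k, counit_def, Matrix.smul_apply, Matrix.one_apply, Matrix.one_apply]
  split_ifs
  · simp
  · exact (smul_zero _).trans (map_zero (toDual F H k)).symm

variable [Fintype ι]

lemma lift_comul_mul (k : HopfDual F H) (a b : Matrix ι ι F) (i j : ι) :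
    TensorProduct.lift ((LinearMap.mul F (Matrix ι ι F)).compl₁₂ (ρ.toLinearMap.flip a)
      (ρ.toLinearMap.flip b)) (Coalgebra.comul (R := F) k) i j =
      ev F H ((coaction ρ a * coaction ρ b) i j) k := by
  have key : ∀ z : TensorProduct F (HopfDual F H) (HopfDual F H),
      TensorProduct.lift ((LinearMap.mul F (Matrix ι ι F)).compl₁₂ (ρ.toLinearMap.flip a)
        (ρ.toLinearMap.flip b)) z i j = ∑ l, ev₂ (coaction ρ a i l) (coaction ρ b l j) z := by
    intro z
    induction z with
    | zero => simp
    | add x y hx hy => simp [hx, hy, Finset.sum_add_distrib]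
    | tmul f g => simp [ev_coaction, Matrix.mul_apply]
  rw [key, comul_def]
  simp only [ev₂_comulMap, Matrix.mul_apply]
  exact (map_sum (toDual F H k) _ _).symm

/-- The coproduct legs come in the order `a, b` but the matrix product in the order `b, a`;
commutativity of `H` reconciles them. -/
lemma lift_comul_mul_swap (k : HopfDual F H) (a b : Matrix ι ι F) (i j : ι) :
    TensorProduct.lift ((LinearMap.mul F (Matrix ι ι F)).flip.compl₁₂ (ρ.toLinearMap.flip a)
      (ρ.toLinearMap.flip b)) (Coalgebra.comul (R := F) k) i j =
      ev F H ((coaction ρ b * coaction ρ a) i j) k := by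
  have key : ∀ z : TensorProduct F (HopfDual F H) (HopfDual F H),
      TensorProduct.lift ((LinearMap.mul F (Matrix ι ι F)).flip.compl₁₂ (ρ.toLinearMap.flip a)
        (ρ.toLinearMap.flip b)) z i j = ∑ l, ev₂ (coaction ρ a l j) (coaction ρ b i l) z := by
    intro z
    induction z with
    | zero => simp
    | add x y hx hy => simp [hx, hy, Finset.sum_add_distrib]
    | tmul f g => simp [ev_coaction, Matrix.mul_apply, mul_comm]
  rw [key, comul_def]
  simp only [ev₂_comulMap, Matrix.mul_apply, mul_comm (coaction ρ a _ _)]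
  exact (map_sum (toDual F H k) _ _).symm

lemma coaction_lie (hLie : IsModuleAlgebra ρ (commutatorProduct F (Matrix ι ι F)))
    (a b : Matrix ι ι F) : coaction ρ ⁅a, b⁆ = ⁅coaction ρ a, coaction ρ b⁆ := by
  have hcomm : commutatorProduct F (Matrix ι ι F) =
      LinearMap.mul F (Matrix ι ι F) - (LinearMap.mul F (Matrix ι ι F)).flip := rfl
  have hlift : ∀ z, TensorProduct.lift ((commutatorProduct F (Matrix ι ι F)).compl₁₂
      (ρ.toLinearMap.flip a) (ρ.toLinearMap.flip b)) z =
      TensorProduct.lift ((LinearMap.mul F (Matrix ι ι F)).compl₁₂ (ρ.toLinearMap.flip a)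
        (ρ.toLinearMap.flip b)) z -
      TensorProduct.lift ((LinearMap.mul F (Matrix ι ι F)).flip.compl₁₂ (ρ.toLinearMap.flip a)
        (ρ.toLinearMap.flip b)) z := by
    intro z
    induction z with
    | zero => simp
    | add x y hx hy => rw [map_add, map_add, map_add, hx, hy]; abel
    | tmul f g => rfl
  ext i j
  refine ev_injective (F := F) fun k ↦ ?_
  have h := congrFun (congrFun (hLie k a b) i) j
  rw [hlift, Matrix.sub_apply, lift_comul_mul, lift_comul_mul_swap] at h
  rw [ev_coaction, Ring.lie_def (coaction ρ a), Matrix.sub_apply]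
  exact h.trans (map_sub (toDual F H k) _ _).symm

/-- For a finite-dimensional commutative Hopf algebra `H` whose augmentation ideal lies in the
Jacobson radical, a unital action of `H*` on the Lie algebra of `n × n` matrices respects the
associative product. -/
theorem isModuleAlgebra_mul_of_commutatorProduct (h2 : (2 : F) ≠ 0)
    (hι : (Fintype.card ι : F) ≠ 0)
    (hε : RingHom.ker (Bialgebra.counitAlgHom F H) ≤ Ideal.jacobson ⊥)
    (hLie : IsModuleAlgebra ρ (commutatorProduct F (Matrix ι ι F)))
    (hone : IsInvariantElement ρ 1) : IsModuleAlgebra ρ (LinearMap.mul F (Matrix ι ι F)) := by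
  have : IsNoetherianRing H := isNoetherian_of_tower F inferInstance
  intro k a b
  ext i j
  rw [lift_comul_mul, ← Matrix.map_mul_of_map_lie h2 hι (Bialgebra.counitAlgHom F H) hε
    (coaction ρ) (coaction_map_counit ρ) (coaction_one ρ hone) (coaction_lie ρ hLie), ev_coaction]
  rfl

end Coaction

end HopfDual

/-! ### The augmentation ideal of a finite abelian `p`-group -/

/-- The augmentation ideal of a finite abelian `p`-group in characteristic `p` is nil. -/
lemma MonoidAlgebra.ker_counit_le_jacobson {F G : Type*} [Field F] {p : ℕ} [Fact p.Prime]
    [CharP F p] [CommGroup G] [Finite G] (hG : IsPGroup p G) :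
    RingHom.ker (Bialgebra.counitAlgHom F (MonoidAlgebra F G)) ≤ Ideal.jacobson ⊥ := by
  obtain ⟨m, hm⟩ := IsPGroup.iff_card.mp hG
  have : CharP (MonoidAlgebra F G) p := charP_of_injective_algebraMap' F p
  -- With `p ^ m = |G|`, the iterated Frobenius is additive and sends each group element to `1`.
  have hpow : ∀ x : MonoidAlgebra F G, x ^ p ^ m =
      algebraMap F _ (Bialgebra.counitAlgHom F (MonoidAlgebra F G) x ^ p ^ m) := by
    intro x
    induction x using MonoidAlgebra.induction_linear with
    | zero => simp [(Fact.out : p.Prime).ne_zero]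
    | add x y hx hy => rw [add_pow_char_pow, map_add, add_pow_char_pow, map_add, hx, hy]
    | single g r =>
      rw [MonoidAlgebra.single_pow, ← hm, pow_card_eq_one']
      simp
  intro x hx
  refine Ideal.radical_le_jacobson ⟨p ^ m, ?_⟩
  rw [Ideal.mem_bot, hpow, RingHom.mem_ker.mp hx, zero_pow (pow_ne_zero _
    (Fact.out : p.Prime).ne_zero), map_zero]

end

theorem mainTheorem2 {F : Type*} [Field F] {p : ℕ} [Fact p.Prime] [CharP F p] (hp : p ≠ 2)
    {n : ℕ} (hn : ¬ p ∣ n) {G : Type*} [CommGroup G] [Finite G] (hG : IsPGroup p G)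
    (ρ : HopfDual F (MonoidAlgebra F G) →ₐ[F] Module.End F (Matrix (Fin n) (Fin n) F))
    (hLie : IsModuleAlgebra ρ (commutatorProduct F (Matrix (Fin n) (Fin n) F)))
    (hone : IsInvariantElement ρ 1) :
    IsModuleAlgebra ρ (LinearMap.mul F (Matrix (Fin n) (Fin n) F)) ∧ IsInvariantElement ρ 1 := by
  have h2 : (2 : F) ≠ 0 := Ring.two_ne_zero ((ringChar.eq F p).symm ▸ hp)
  have hι : (Fintype.card (Fin n) : F) ≠ 0 := by
    rwa [Fintype.card_fin, Ne, CharP.cast_eq_zero_iff F p]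
  exact ⟨HopfDual.isModuleAlgebra_mul_of_commutatorProduct ρ h2 hι
    (MonoidAlgebra.ker_counit_le_jacobson hG) hLie hone, hone⟩
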